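/- Let $\mathbb S$ be the unit sphere of $\mathbb R^3$ with its uniform (surface) measure $d\xi$ of total mass $4\pi$, and let $(X(\xi))_{\xi\in\mathbb S}$ be a real-valued, measurable, square integrable, zero-mean random field which is mean square continuous and second-order stationary, i.e. $\mathbf E[X(\rho\xi)X(\rho\xi')]=\mathbf E[X(\xi)X(\xi')]$ for all $\xi,\xi'\in\mathbb S$ and $\rho\in SO(3)$. Let $a_{\ell,m}=\int_{\mathbb S}X(\xi)\overline{\mathcal Y_{\ell,m}(\xi)}\,d\xi$ be its coefficients in the usual orthonormal spherical harmonics $\mathcal Y_{\ell,m}$ ($\ell\ge 0$, $-\ell\le m\le \ell$), and let $(C_\ell)_{\ell\ge0}$ be its angular power spectrum, that is, the sequence for which $\mathbf E[a_{\ell,m}\overline{a_{\ell',m'}}]=\delta_{\ell,\ell'}\delta_{m,m'}C_\ell$ for $m,m'\ge0$; in particular $C_\ell=\mathbf E|a_{\ell,0}|^2$. Let $L_\ell$ be the Legendre polynomial of degree $\ell$ normalized by $L_\ell(1)=\frac{2\ell+1}{4\pi}$. For every scale $j\in\mathbb N$ let $b_j=(b_{j,\ell})_{\ell\ge0}$ be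 a real sequence with $b_{j,\ell}=0$ for $\ell>L_j^{(b)}$, where $L_j^{(b)}\in\mathbb N$, and let $\xi_{j,k}\in\mathbb S$ and $\lambda_{j,k}>0$, $1\le k\le N_j$, be finitely many points and weights (for instance the cubature points and weights of a pixelization of the sphere). The needlets are $\psi_{j,k}(\xi)=\sqrt{\lambda_{j,k}}\sum_{\ell\ge0}b_{j,\ell}L_\ell(\xi\cdot\xi_{j,k})$, and the needlet coefficients of $X$ are $\eta_{j,k}=\lambda_{j,k}^{-1/2}\int_{\mathbb S}X(\xi)\psi_{j,k}(\xi)\,d\xi$. Then the $\eta_{j,k}$ are square integrable and centered, $\mathbf E[\eta_{j,k}]=0$, and for all $j\in\mathbb N$ and $k,k'\in\{1,\dots,N_j\}$ $$\operatorname{Cov}[\eta_{j,k},\eta_{j,k'}]=\sum_{\ell\ge0}(b_{j,\ell})^2\,C_\ell\,L_\ell(\xi_{j,k}\cdot\xi_{j,k'}).$$ -/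

import Mathlib

open MeasureTheory ProbabilityTheory Filter Topology

noncomputable section

namespace Needlet

/-- Euclidean space `ℝ³`. -/
abbrev E3 : Type := EuclideanSpace ℝ (Fin 3)

/-- The unit sphere of `ℝ³`. -/
abbrev S2 : Type := Metric.sphere (0 : E3) 1

/-- The uniform measure `dξ` on the sphere (the surface measure, rotation invariant, of total
mass `4π`). -/
def sphereMeasure : Measure S2 := (volume : Measure E3).toSphere

/-- The dot product `ξ · ξ'` of two points of the sphere, as vectors of `ℝ³`. -/
def dot (x y : S2) : ℝ := inner ℝ (x : E3) (y : E3)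

/-- The classical Legendre polynomial `P_ℓ` (Rodrigues' formula), for which `P_ℓ(1) = 1`. -/
def legendreP (l : ℕ) : Polynomial ℝ :=
  Polynomial.C ((2 ^ l * (l.factorial : ℝ))⁻¹) *
    Polynomial.derivative^[l] ((Polynomial.X ^ 2 - 1) ^ l)

/-- The Legendre polynomial of degree `ℓ` normalized by `L_ℓ(1) = (2ℓ + 1) / (4π)`. -/
def legendreL (l : ℕ) : Polynomial ℝ :=
  Polynomial.C ((2 * (l : ℝ) + 1) / (4 * Real.pi)) * legendreP l

/-- The usual orthonormal spherical harmonic `Y_{ℓ,m}`, `-ℓ ≤ m ≤ ℓ`, in Cartesian coordinates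
`ξ = (x, y, z) = (sin θ cos φ, sin θ sin φ, cos θ)`, for which
`sin^{|m|} θ e^{i m φ} = (x ± i y)^{|m|}`. The phase is the one with
`Y_{ℓ,-m} = conj Y_{ℓ,m}`. -/
def sphericalHarmonic (l : ℕ) (m : ℤ) (x : S2) : ℂ :=
  (Real.sqrt ((2 * (l : ℝ) + 1) / (4 * Real.pi) *
      (((l - m.natAbs).factorial : ℝ) / ((l + m.natAbs).factorial : ℝ))) : ℂ) *
    (((x : E3) 0 : ℂ) + (m.sign : ℂ) * Complex.I * ((x : E3) 1 : ℂ)) ^ m.natAbs *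
    (((Polynomial.derivative^[m.natAbs] (legendreP l)).eval ((x : E3) 2) : ℝ) : ℂ)

/-- The action on the sphere of a linear isometry of `ℝ³`. -/
def rotate (ρ : E3 ≃ₗᵢ[ℝ] E3) (x : S2) : S2 := ⟨ρ x, by simp⟩

section Field

variable {Ω : Type*} [MeasurableSpace Ω]

/-- A zero-mean, mean square continuous, second-order stationary real random field on the sphere.
A rotation (an element of `SO(3)`) is a linear isometry of `ℝ³` of determinant `1`. The
measurability makes the integrals of the sample paths over the sphere random variables. -/
structure IsStationaryField (P : Measure Ω) (X : S2 → Ω → ℝ) : Prop where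
  aestronglyMeasurable :
    AEStronglyMeasurable (fun q : S2 × Ω => X q.1 q.2) (sphereMeasure.prod P)
  memLp : ∀ x, MemLp (X x) 2 P
  mean_zero : ∀ x, ∫ ω, X x ω ∂P = 0
  mean_square_continuous :
    ∀ x, Tendsto (fun y => ∫ ω, (X y ω - X x ω) ^ 2 ∂P) (𝓝 x) (𝓝 0)
  stationary : ∀ ρ : E3 ≃ₗᵢ[ℝ] E3, LinearMap.det (ρ.toLinearEquiv : E3 →ₗ[ℝ] E3) = 1 →
    ∀ x y, ∫ ω, X (rotate ρ x) ω * X (rotate ρ y) ω ∂P = ∫ ω, X x ω * X y ω ∂P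

/-- The (random) spherical harmonics coefficient `a_{ℓ,m} = ⟨X, Y_{ℓ,m}⟩` in `L²(dξ)`. -/
def harmonicCoeff (X : S2 → Ω → ℝ) (l : ℕ) (m : ℤ) (ω : Ω) : ℂ :=
  ∫ x, (X x ω : ℂ) * (starRingEnd ℂ) (sphericalHarmonic l m x) ∂sphereMeasure

/-- The angular power spectrum `C_ℓ` of a stationary field. The relation
`E[a_{ℓ,m} conj a_{ℓ',m'}] = δ_{ℓ,ℓ'} δ_{m,m'} C_ℓ` that characterizes it forces
`C_ℓ = E |a_{ℓ,0}|²`; the other instances of the relation are not presupposed here. -/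
def powerSpectrum (P : Measure Ω) (X : S2 → Ω → ℝ) (l : ℕ) : ℝ :=
  ∫ ω, ‖harmonicCoeff X l 0 ω‖ ^ 2 ∂P

/-- The needlet with window `b`, centre `c` and weight `w`:
`ψ(ξ) = √w ∑_ℓ b_ℓ L_ℓ(ξ · c)` (a finite sum for a window of bounded support). -/
def needlet (b : ℕ → ℝ) (c : S2) (w : ℝ) (x : S2) : ℝ :=
  Real.sqrt w * ∑' l : ℕ, b l * (legendreL l).eval (dot x c)

/-- The (renormalized) needlet coefficient `w^{-1/2} ⟨X, ψ⟩` of the random field `X`. -/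
def needletCoeff (b : ℕ → ℝ) (c : S2) (w : ℝ) (X : S2 → Ω → ℝ) (ω : Ω) : ℝ :=
  (Real.sqrt w)⁻¹ * ∫ x, X x ω * needlet b c w x ∂sphereMeasure

end Field

end Needlet

end

/-!
A rotation-invariant kernel on the sphere acts on zonal functions by a self-adjoint operator which
does not raise the degree of zonal polynomials. By Archimedes' theorem the inner product of two
zonal polynomials with the same axis is their `L²` product on `[-1, 1]`, so the operator is diagonal
on the Legendre polynomials (Funk–Hecke). For the covariance kernel of an isotropic field the
eigenvalue of degree `ℓ` is `C_ℓ`, and for the kernel `L_m (x · y)` it is `δ_{ℓ,m}`. The covariance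
of two needlet coefficients, a double integral of the two needlets against the covariance kernel,
is therefore evaluated by applying the operator to one needlet, which multiplies `b_ℓ` by `C_ℓ`, and
pairing the result with the other one.
-/

namespace Needlet

open Polynomial

section Legendre

lemma eval_iterate_derivative_X_sub_C_pow_mul {R : Type*} [CommRing R] (n : ℕ) (a : R)
    (g : R[X]) : (derivative^[n] ((X - C a) ^ n * g)).eval a = n.factorial * g.eval a := by
  rw [← factorial_smul_hasseDeriv, LinearMap.smul_apply, eval_smul, ← taylor_coeff, nsmul_eq_mul,
    taylor_mul, taylor_pow, map_sub, taylor_X, taylor_C, add_sub_cancel_right,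
    mul_comm (X ^ n), coeff_mul_X_pow', if_pos le_rfl, Nat.sub_self, taylor_coeff_zero]

lemma legendreP_eval_one (n : ℕ) : (legendreP n).eval 1 = 1 := by
  have hfactor : ((X : ℝ[X]) ^ 2 - 1) ^ n = (X - C 1) ^ n * (X + 1) ^ n := by
    rw [← mul_pow, C_1]
    ring
  rw [legendreP, eval_mul, eval_C, hfactor, eval_iterate_derivative_X_sub_C_pow_mul]
  simp only [eval_pow, eval_add, eval_X, eval_one]
  field_simp
  norm_num

lemma legendreP_eval_neg_one (n : ℕ) : (legendreP n).eval (-1) = (-1) ^ n := by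
  have hfactor : ((X : ℝ[X]) ^ 2 - 1) ^ n = (X - C (-1)) ^ n * (X - 1) ^ n := by
    rw [← mul_pow, C_neg, C_1]
    ring
  rw [legendreP, eval_mul, eval_C, hfactor, eval_iterate_derivative_X_sub_C_pow_mul]
  simp only [eval_pow, eval_sub, eval_X, eval_one]
  rw [show (-1 - 1 : ℝ) = (-1) * 2 by norm_num, mul_pow]
  field_simp

lemma legendreP_mem_degreeLT (n : ℕ) : legendreP n ∈ degreeLT ℝ (n + 1) := by
  have hdeg : (((X : ℝ[X]) ^ 2 - 1) ^ n).natDegree = n * 2 := by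
    rw [natDegree_pow, ← C_1, natDegree_X_pow_sub_C]
  have hle : (legendreP n).natDegree ≤ n :=
    (natDegree_C_mul_le _ _).trans ((natDegree_iterate_derivative _ _).trans (by omega))
  exact mem_degreeLT.mpr (degree_le_natDegree.trans_lt (by exact_mod_cast Nat.lt_succ_of_le hle))

lemma mem_degreeLT_of_coeff_eq_zero {R : Type*} [Semiring R] {n : ℕ} {p : R[X]}
    (hp : p ∈ degreeLT R (n + 1)) (hn : p.coeff n = 0) : p ∈ degreeLT R n := by
  rw [mem_degreeLT, degree_lt_iff_coeff_zero] at hp ⊢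
  intro m hm
  rcases hm.eq_or_lt with rfl | hlt
  · exact hn
  · exact hp m hlt

/-- Integration of polynomials over `[-1, 1]`, as a linear functional. -/
noncomputable def segmentIntegral : ℝ[X] →ₗ[ℝ] ℝ where
  toFun p := ∫ t in (-1 : ℝ)..1, p.eval t
  map_add' p q := by
    simp only [eval_add]
    exact intervalIntegral.integral_add (p.continuous.intervalIntegrable _ _)
      (q.continuous.intervalIntegrable _ _)
  map_smul' a p := by simp

lemma segmentIntegral_derivative (p : ℝ[X]) :
    segmentIntegral (derivative p) = p.eval 1 - p.eval (-1) :=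
  intervalIntegral.integral_eq_sub_of_hasDerivAt (fun x _ => p.hasDerivAt x)
    ((derivative p).continuous.intervalIntegrable _ _)

lemma eq_zero_of_segmentIntegral_mul_self_eq_zero {p : ℝ[X]} (h : segmentIntegral (p * p) = 0) :
    p = 0 := by
  have hroot : ∀ t ∈ Set.Icc (-1 : ℝ) 1, p.IsRoot t := by
    by_contra! ⟨t, ht, hne⟩
    have hpos : 0 < segmentIntegral (p * p) :=
      intervalIntegral.integral_pos (by norm_num) (p * p).continuous.continuousOn
        (fun x _ => eval_mul (R := ℝ) ▸ mul_self_nonneg _)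
        ⟨t, ht, eval_mul (R := ℝ) ▸ mul_self_pos.mpr hne⟩
    exact hpos.ne' h
  exact eq_zero_of_infinite_isRoot p ((Set.Icc_infinite (by norm_num)).mono hroot)

lemma segmentIntegral_iterate_derivative_mul {n k : ℕ} (hk : k ≤ n) {p : ℝ[X]}
    (hp : p ∈ degreeLT ℝ k) :
    segmentIntegral (derivative^[k] ((X ^ 2 - 1) ^ n) * p) = 0 := by
  induction k generalizing p with
  | zero =>
    have hp0 : p = 0 := by simpa [mem_degreeLT] using hp
    rw [hp0, mul_zero, map_zero]
  | succ k ih =>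
    set D := derivative^[k] (((X : ℝ[X]) ^ 2 - 1) ^ n)
    have hdvd : X ^ 2 - 1 ∣ D := (dvd_pow_self _ (by omega)).trans
      (pow_sub_dvd_iterate_derivative_of_pow_dvd k (dvd_refl ((X ^ 2 - 1) ^ n)))
    have hboundary : ∀ t : ℝ, t ^ 2 = 1 → D.eval t = 0 := fun t ht =>
      eval_eq_zero_of_dvd_of_eval_eq_zero hdvd (by simp [ht])
    have hp' : derivative p ∈ degreeLT ℝ k := by
      rw [mem_degreeLT, degree_lt_iff_coeff_zero] at hp ⊢
      intro m hm
      rw [coeff_derivative, hp (m + 1) (by omega), zero_mul]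
    have hparts := segmentIntegral_derivative (D * p)
    rwa [derivative_mul, map_add, ih (by omega) hp', add_zero, eval_mul, eval_mul,
      hboundary 1 (by norm_num), hboundary (-1) (by norm_num), zero_mul, zero_mul, sub_zero,
      ← Function.iterate_succ_apply' derivative] at hparts

lemma segmentIntegral_legendreP_mul {n : ℕ} {p : ℝ[X]} (hp : p ∈ degreeLT ℝ n) :
    segmentIntegral (legendreP n * p) = 0 := by
  rw [legendreP, mul_assoc, C_mul', map_smul, segmentIntegral_iterate_derivative_mul le_rfl hp,
    smul_zero]

lemma segmentIntegral_legendreP_mul_of_ne {l m : ℕ} (h : l ≠ m) :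
    segmentIntegral (legendreP l * legendreP m) = 0 := by
  wlog hlt : m < l generalizing l m
  · rw [mul_comm]
    exact this h.symm (by omega)
  exact segmentIntegral_legendreP_mul (degreeLT_mono hlt (legendreP_mem_degreeLT m))

lemma segmentIntegral_legendreP_mul_self (n : ℕ) :
    segmentIntegral (legendreP n * legendreP n) = 2 / (2 * n + 1) := by
  set p := legendreP n
  have hcoeff : ∀ m, (X * derivative p - (n : ℝ) • p).coeff m = (m - n) * p.coeff m := by
    rintro (_ | m)
    · simp
    · rw [coeff_sub, coeff_X_mul, coeff_derivative, coeff_smul, smul_eq_mul]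
      push_cast
      ring
  have hlow : X * derivative p - (n : ℝ) • p ∈ degreeLT ℝ n := by
    refine mem_degreeLT_of_coeff_eq_zero ?_ (by rw [hcoeff, sub_self, zero_mul])
    rw [mem_degreeLT, degree_lt_iff_coeff_zero]
    intro m hm
    rw [hcoeff, (degree_lt_iff_coeff_zero _ _).mp (mem_degreeLT.mp (legendreP_mem_degreeLT n)) m hm,
      mul_zero]
  have hderiv : derivative (X * (p * p)) =
      (2 * n + 1 : ℝ) • (p * p) + (2 : ℝ) • (p * (X * derivative p - (n : ℝ) • p)) := by
    simp only [derivative_mul, derivative_X, smul_eq_C_mul, map_add, map_mul, map_one,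
      map_natCast, map_ofNat]
    ring
  have hint := segmentIntegral_derivative (X * (p * p))
  rw [hderiv, map_add, map_smul, map_smul, segmentIntegral_legendreP_mul hlow] at hint
  simp only [eval_mul, eval_X, p, legendreP_eval_one, legendreP_eval_neg_one, ← mul_pow,
    smul_eq_mul] at hint
  rw [eq_div_iff (by positivity)]
  norm_num at hint
  linarith

lemma coeff_legendreP_ne_zero (n : ℕ) : (legendreP n).coeff n ≠ 0 := by
  intro h
  have hzero : legendreP n = 0 := eq_zero_of_segmentIntegral_mul_self_eq_zero
    (segmentIntegral_legendreP_mul (mem_degreeLT_of_coeff_eq_zero (legendreP_mem_degreeLT n) h))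
  simpa [hzero] using legendreP_eval_one n

lemma eq_smul_legendreP {n : ℕ} {q : ℝ[X]} (hq : q ∈ degreeLT ℝ (n + 1))
    (h : ∀ p ∈ degreeLT ℝ n, segmentIntegral (q * p) = 0) : q = q.eval 1 • legendreP n := by
  set a := q.coeff n / (legendreP n).coeff n
  set r := q - a • legendreP n
  have hr : r ∈ degreeLT ℝ n := by
    refine mem_degreeLT_of_coeff_eq_zero
      (sub_mem hq (Submodule.smul_mem _ a (legendreP_mem_degreeLT n))) ?_
    rw [coeff_sub, coeff_smul, smul_eq_mul, div_mul_cancel₀ _ (coeff_legendreP_ne_zero n), sub_self]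
  have hrr : segmentIntegral (r * r) = 0 := by
    rw [show r * r = q * r - a • (legendreP n * r) by rw [← smul_mul_assoc, ← sub_mul],
      map_sub, map_smul, h r hr, segmentIntegral_legendreP_mul hr, smul_zero, sub_zero]
  have hqa : q = a • legendreP n :=
    sub_eq_zero.mp (eq_zero_of_segmentIntegral_mul_self_eq_zero hrr)
  have ha : q.eval 1 = a := by rw [hqa, eval_smul, legendreP_eval_one, smul_eq_mul, mul_one]
  rwa [ha]

/-- A linear functional with this property satisfies the recursion of the moments of `[-1, 1]`:
take `p = X ^ (n + 1)`. -/
lemma eq_smul_segmentIntegral {Λ : ℝ[X] →ₗ[ℝ] ℝ}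
    (h : ∀ p, Λ (derivative ((X ^ 2 - 1) * p)) = 0) : Λ = (Λ 1 / 2) • segmentIntegral := by
  set Φ := Λ - (Λ 1 / 2) • segmentIntegral with hΦ
  have hΦ_derivative : ∀ p, Φ (derivative ((X ^ 2 - 1) * p)) = 0 := fun p => by
    rw [hΦ, LinearMap.sub_apply, LinearMap.smul_apply, h, segmentIntegral_derivative]
    simp
  have hΦ_X_pow : ∀ n, Φ (X ^ n) = 0 := by
    intro n
    induction n using Nat.twoStepInduction with
    | zero =>
      have h2 : segmentIntegral 1 = 2 := by norm_num [segmentIntegral]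
      simp [hΦ, h2]
    | one =>
      have hX : derivative ((X ^ 2 - 1) * 1 : ℝ[X]) = (2 : ℝ) • X ^ 1 := by
        simp [smul_eq_C_mul, one_add_one_eq_two]
      have h2 := hΦ_derivative 1
      rw [hX, map_smul] at h2
      exact (smul_eq_zero.mp h2).resolve_left two_ne_zero
    | more n ih _ =>
      have hX : derivative ((X ^ 2 - 1) * X ^ (n + 1) : ℝ[X]) =
          (n + 3 : ℝ) • X ^ (n + 2) - (n + 1 : ℝ) • X ^ n := by
        simp only [derivative_mul, derivative_sub, derivative_X_pow, derivative_one,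
          smul_eq_C_mul, map_add, map_natCast, map_ofNat, map_one, Nat.add_sub_cancel]
        push_cast
        ring
      have hrec := hΦ_derivative (X ^ (n + 1))
      rw [hX, map_sub, map_smul, map_smul, ih, smul_zero, sub_zero] at hrec
      exact (smul_eq_zero.mp hrec).resolve_left (by positivity)
  refine sub_eq_zero.mp (lhom_ext' fun n => LinearMap.ext_ring ?_)
  rw [LinearMap.comp_apply, monomial_one_right_eq_X_pow]
  exact hΦ_X_pow n

end Legendre

section LinearIsometries

variable {E : Type*} [NormedAddCommGroup E] [InnerProductSpace ℝ E]

lemma exists_linearIsometryEquiv_map_pair {x y x' y' : E} (hx : ‖x‖ = ‖x'‖) (hy : ‖y‖ = ‖y'‖)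
    (hxy : inner ℝ x y = inner ℝ x' y') : ∃ ρ : E ≃ₗᵢ[ℝ] E, ρ x = x' ∧ ρ y = y' := by
  set ρ₁ := (ℝ ∙ (x - x'))ᗮ.reflection
  have hρ₁ : ρ₁ x = x' := Submodule.reflection_sub hx
  set ρ₂ := (ℝ ∙ (ρ₁ y - y'))ᗮ.reflection
  have hρ₂ : ρ₂ (ρ₁ y) = y' := Submodule.reflection_sub (by rw [ρ₁.norm_map, hy])
  have hfix : ρ₂ x' = x' := by
    refine Submodule.reflection_mem_subspace_eq_self ?_
    rw [Submodule.mem_orthogonal_singleton_iff_inner_left, inner_sub_right, sub_eq_zero]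
    calc inner ℝ x' (ρ₁ y) = inner ℝ (ρ₁ x) (ρ₁ y) := by rw [hρ₁]
      _ = inner ℝ x' y' := by rw [ρ₁.inner_map_map, hxy]
  exact ⟨ρ₁.trans ρ₂, by simp [hρ₁, hfix], by simp [hρ₂]⟩

lemma exists_linearIsometryEquiv_det_eq_neg_one [FiniteDimensional ℝ E]
    (hE : 2 < Module.finrank ℝ E) (x y : E) : ∃ σ : E ≃ₗᵢ[ℝ] E,
      LinearMap.det (σ.toLinearEquiv : E →ₗ[ℝ] E) = -1 ∧ σ x = x ∧ σ y = y := by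
  set S := Submodule.span ℝ {x, y}
  obtain ⟨v, hv, hv0⟩ : ∃ v ∈ Sᗮ, v ≠ 0 := by
    refine Submodule.exists_mem_ne_zero_of_ne_bot fun hbot => ?_
    have hsum := S.finrank_add_finrank_orthogonal
    have hS : Module.finrank ℝ S ≤ 2 := by
      classical
      refine (finrank_span_le_card _).trans ?_
      rw [Set.toFinset_insert, Set.toFinset_singleton]
      exact Finset.card_le_two
    rw [hbot, finrank_bot] at hsum
    omega
  have hfix : ∀ z ∈ S, (ℝ ∙ v)ᗮ.reflection z = z := fun z hz =>
    Submodule.reflection_mem_subspace_eq_self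
      (Submodule.mem_orthogonal_singleton_iff_inner_left.mpr (hv z hz))
  refine ⟨(ℝ ∙ v)ᗮ.reflection, ?_, hfix x (Submodule.subset_span (by simp)),
    hfix y (Submodule.subset_span (by simp))⟩
  rw [Submodule.det_reflection, Submodule.orthogonal_orthogonal, finrank_span_singleton hv0,
    pow_one]

lemma exists_linearIsometryEquiv_det_eq_one_map_pair [FiniteDimensional ℝ E]
    (hE : 2 < Module.finrank ℝ E) {x y x' y' : E} (hx : ‖x‖ = ‖x'‖) (hy : ‖y‖ = ‖y'‖)
    (hxy : inner ℝ x y = inner ℝ x' y') : ∃ ρ : E ≃ₗᵢ[ℝ] E,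
      LinearMap.det (ρ.toLinearEquiv : E →ₗ[ℝ] E) = 1 ∧ ρ x = x' ∧ ρ y = y' := by
  obtain ⟨ρ, hρx, hρy⟩ := exists_linearIsometryEquiv_map_pair hx hy hxy
  have hdet : |LinearMap.det (ρ.toLinearEquiv : E →ₗ[ℝ] E)| = 1 := by
    rw [← LinearMap.normDet_eq_abs_det]
    exact ρ.toLinearIsometry.normDet_eq_one
  rcases eq_or_eq_neg_of_abs_eq hdet with hpos | hneg
  · exact ⟨ρ, hpos, hρx, hρy⟩
  obtain ⟨σ, hσ, hσx, hσy⟩ := exists_linearIsometryEquiv_det_eq_neg_one hE x y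
  refine ⟨σ.trans ρ, ?_, by simp [hσx, hρx], by simp [hσy, hρy]⟩
  rw [LinearIsometryEquiv.toLinearEquiv_trans, LinearEquiv.coe_trans, LinearMap.det_comp, hneg, hσ]
  norm_num

end LinearIsometries

section Sphere

lemma dot_comm (x y : S2) : dot x y = dot y x := real_inner_comm _ _

lemma dot_self (x : S2) : dot x x = 1 := by
  rw [dot, real_inner_self_eq_norm_sq, norm_eq_of_mem_sphere x, one_pow]

lemma dot_neg_right (x y : S2) : dot x (-y) = -dot x y := by simp [dot]

lemma abs_dot_le_one (x y : S2) : |dot x y| ≤ 1 := by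
  simpa [dot, norm_eq_of_mem_sphere] using abs_real_inner_le_norm (x : E3) (y : E3)

lemma dot_rotate (ρ : E3 ≃ₗᵢ[ℝ] E3) (x y : S2) : dot (rotate ρ x) (rotate ρ y) = dot x y :=
  ρ.inner_map_map _ _

@[fun_prop]
lemma continuous_dot {T : Type*} [TopologicalSpace T] {f g : T → S2} (hf : Continuous f)
    (hg : Continuous g) : Continuous fun t => dot (f t) (g t) := by
  unfold dot
  fun_prop

lemma exists_rotate_pair {x y x' y' : S2} (h : dot x y = dot x' y') : ∃ ρ : E3 ≃ₗᵢ[ℝ] E3,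
    LinearMap.det (ρ.toLinearEquiv : E3 →ₗ[ℝ] E3) = 1 ∧ rotate ρ x = x' ∧ rotate ρ y = y' := by
  obtain ⟨ρ, hρ, hx, hy⟩ := exists_linearIsometryEquiv_det_eq_one_map_pair
    (by rw [finrank_euclideanSpace_fin]; norm_num) (x := (x : E3)) (y := y) (x' := x') (y' := y')
    (by simp) (by simp) h
  exact ⟨ρ, hρ, Subtype.ext hx, Subtype.ext hy⟩

/-- The action of a linear isometry on the sphere, as a measurable equivalence. -/
noncomputable def rotateEquiv (ρ : E3 ≃ₗᵢ[ℝ] E3) : S2 ≃ᵐ S2 where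
  toFun := rotate ρ
  invFun := rotate ρ.symm
  left_inv x := Subtype.ext (ρ.symm_apply_apply x)
  right_inv x := Subtype.ext (ρ.apply_symm_apply x)
  measurable_toFun := ((ρ.continuous.comp continuous_subtype_val).subtype_mk _).measurable
  measurable_invFun := ((ρ.symm.continuous.comp continuous_subtype_val).subtype_mk _).measurable

instance : IsFiniteMeasure sphereMeasure := inferInstanceAs (IsFiniteMeasure (Measure.toSphere _))

open scoped Pointwise in
lemma measurePreserving_rotateEquiv (ρ : E3 ≃ₗᵢ[ℝ] E3) :
    MeasurePreserving (rotateEquiv ρ) sphereMeasure sphereMeasure := by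
  refine ⟨(rotateEquiv ρ).measurable, Measure.ext fun s hs => ?_⟩
  have hcone : ρ ⁻¹' (Set.Ioo (0 : ℝ) 1 • (Subtype.val '' s)) =
      Set.Ioo (0 : ℝ) 1 • (Subtype.val '' (rotateEquiv ρ ⁻¹' s)) := by
    ext v
    simp only [Set.mem_smul, Set.mem_image, Set.mem_preimage]
    constructor
    · rintro ⟨r, hr, _, ⟨x, hx, rfl⟩, hv⟩
      refine ⟨r, hr, _, ⟨rotate ρ.symm x, ?_, rfl⟩, ρ.injective ?_⟩
      · rwa [show rotateEquiv ρ (rotate ρ.symm x) = x from (rotateEquiv ρ).apply_symm_apply x]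
      · rw [map_smul, ← hv]
        exact congrArg (r • ·) (ρ.apply_symm_apply (x : E3))
    · rintro ⟨r, hr, _, ⟨x, hx, rfl⟩, rfl⟩
      exact ⟨r, hr, _, ⟨rotate ρ x, hx, rfl⟩, (map_smul ρ r (x : E3)).symm⟩
  rw [Measure.map_apply (rotateEquiv ρ).measurable hs, sphereMeasure,
    Measure.toSphere_apply' _ hs, Measure.toSphere_apply' _ ((rotateEquiv ρ).measurable hs),
    ← hcone,
    ρ.measurePreserving.measure_preimage_emb ρ.toHomeomorph.measurableEmbedding]

lemma integral_comp_rotate (ρ : E3 ≃ₗᵢ[ℝ] E3) (f : S2 → ℝ) :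
    ∫ x, f (rotate ρ x) ∂sphereMeasure = ∫ x, f x ∂sphereMeasure :=
  (measurePreserving_rotateEquiv ρ).integral_comp' f

lemma sphereMeasure_real_univ : sphereMeasure.real Set.univ = 4 * Real.pi := by
  rw [sphereMeasure, Measure.toSphere_real_apply_univ, measureReal_def,
    EuclideanSpace.volume_ball_fin_three, finrank_euclideanSpace_fin, ENNReal.ofReal_one, one_pow,
    one_mul, ENNReal.toReal_ofReal (by positivity)]
  push_cast
  ring

/-- Invariance of a kernel on the sphere under the diagonal action of `SO(3)`. -/
def IsRotationInvariant (K : S2 → S2 → ℝ) : Prop :=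
  ∀ ρ : E3 ≃ₗᵢ[ℝ] E3, LinearMap.det (ρ.toLinearEquiv : E3 →ₗ[ℝ] E3) = 1 →
    ∀ x y, K (rotate ρ x) (rotate ρ y) = K x y

namespace IsRotationInvariant

variable {K : S2 → S2 → ℝ} (hK : IsRotationInvariant K)
include hK

lemma eq_of_dot_eq {x y x' y' : S2} (h : dot x y = dot x' y') : K x y = K x' y' := by
  obtain ⟨ρ, hρ, rfl, rfl⟩ := exists_rotate_pair h
  exact (hK ρ hρ x y).symm

lemma symm (x y : S2) : K x y = K y x := hK.eq_of_dot_eq (dot_comm x y)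

end IsRotationInvariant

end Sphere

section ZonalIntegrals

lemma integrable_of_continuous {T : Type*} [TopologicalSpace T] [CompactSpace T]
    [MeasurableSpace T] [OpensMeasurableSpace T] {μ : Measure T} [IsFiniteMeasureOnCompacts μ]
    {f : T → ℝ} (hf : Continuous f) : Integrable f μ :=
  hf.integrable_of_hasCompactSupport (.of_compactSpace f)

/-- The north pole `(0, 0, 1)`, the axis of the spherical harmonics of order `0`. -/
noncomputable def northPole : S2 := ⟨EuclideanSpace.single 2 1, by simp⟩

/-- The arc-length parametrization `(cos θ, sin θ, 0)` of the equator. -/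
noncomputable def equator (θ : ℝ) : S2 :=
  ⟨!₂[Real.cos θ, Real.sin θ, 0], by simp [EuclideanSpace.norm_eq, Fin.sum_univ_three]⟩

lemma dot_northPole (x : S2) : dot x northPole = (x : E3) 2 := by
  simp [dot, northPole, EuclideanSpace.inner_single_right]

lemma dot_equator (x : S2) (θ : ℝ) :
    dot x (equator θ) = Real.cos θ * (x : E3) 0 + Real.sin θ * (x : E3) 1 := by
  simp [dot, equator, PiLp.inner_apply, Fin.sum_univ_three]

lemma dot_equator_eq_add (x : S2) (θ : ℝ) : dot x (equator θ) =
    Real.cos θ * dot x (equator 0) + Real.sin θ * dot x (equator (Real.pi / 2)) := by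
  simp [dot_equator]

lemma dot_equator_equator (θ φ : ℝ) : dot (equator θ) (equator φ) = Real.cos (φ - θ) := by
  rw [dot_equator, Real.cos_sub]
  rfl

lemma dot_equator_northPole (θ : ℝ) : dot (equator θ) northPole = 0 := dot_northPole _

lemma hasDerivAt_dot_equator (x : S2) (θ : ℝ) :
    HasDerivAt (fun θ => dot x (equator θ)) (dot x (equator (θ + Real.pi / 2))) θ := by
  simp only [dot_equator, Real.cos_add_pi_div_two, Real.sin_add_pi_div_two]
  exact ((Real.hasDerivAt_cos θ).mul_const _).add ((Real.hasDerivAt_sin θ).mul_const _)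

lemma hasDerivAt_eval_dot_equator_mul (p : ℝ[X]) (x : S2) (θ : ℝ) :
    HasDerivAt (fun θ => p.eval (dot x (equator θ)) * dot x (equator (θ + Real.pi / 2)))
      ((derivative p).eval (dot x (equator θ)) * dot x (equator (θ + Real.pi / 2)) ^ 2 -
        p.eval (dot x (equator θ)) * dot x (equator θ)) θ := by
  have hv : HasDerivAt (fun θ => dot x (equator (θ + Real.pi / 2))) (-dot x (equator θ)) θ := by
    refine ((hasDerivAt_dot_equator x _).comp_add_const θ (Real.pi / 2)).congr_deriv ?_
    rw [add_assoc, add_halves, dot_equator, dot_equator, Real.cos_add_pi, Real.sin_add_pi]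
    ring
  refine (((p.hasDerivAt _).comp θ (hasDerivAt_dot_equator x θ)).mul hv).congr_deriv ?_
  simp only [Function.comp_apply]
  ring

lemma dot_equator_sq_add_sq_add_sq (x : S2) :
    dot x (equator 0) ^ 2 + dot x (equator (Real.pi / 2)) ^ 2 + dot x northPole ^ 2 = 1 := by
  have hx := EuclideanSpace.real_norm_sq_eq (x : E3)
  rw [norm_eq_of_mem_sphere, one_pow, Fin.sum_univ_three] at hx
  simp [dot_equator, dot_northPole, ← hx]

lemma IsRotationInvariant.integral_mul_dot_eq {K : S2 → S2 → ℝ} (hK : IsRotationInvariant K)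
    {y c y' c' : S2} (h : dot y c = dot y' c') (f : ℝ → ℝ → ℝ) :
    ∫ x, K x y * f (dot x y) (dot x c) ∂sphereMeasure =
      ∫ x, K x y' * f (dot x y') (dot x c') ∂sphereMeasure := by
  obtain ⟨ρ, hρ, rfl, rfl⟩ := exists_rotate_pair h
  rw [← integral_comp_rotate ρ fun x =>
    K x (rotate ρ y) * f (dot x (rotate ρ y)) (dot x (rotate ρ c))]
  simp only [hK ρ hρ, dot_rotate]

lemma integral_dot_dot_eq {y c y' c' : S2} (h : dot y c = dot y' c') (f : ℝ → ℝ → ℝ) :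
    ∫ x, f (dot x y) (dot x c) ∂sphereMeasure = ∫ x, f (dot x y') (dot x c') ∂sphereMeasure := by
  have hone : IsRotationInvariant fun _ _ => 1 := fun _ _ _ _ => rfl
  simpa only [one_mul] using hone.integral_mul_dot_eq h f

/-- The integrand is the derivative of `p (x · u) (x · v)` under the rotation taking `u` to `v`,
hence it vanishes after averaging over the rotations of the plane of `u` and `v`. -/
lemma integral_eval_derivative_dot_mul_sq_sub {u v : S2} (huv : dot u v = 0) (p : ℝ[X]) :
    ∫ x, ((derivative p).eval (dot x u) * dot x v ^ 2 - p.eval (dot x u) * dot x u)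
      ∂sphereMeasure = 0 := by
  let F : S2 → ℝ → ℝ := fun x θ =>
    (derivative p).eval (dot x (equator θ)) * dot x (equator (θ + Real.pi / 2)) ^ 2 -
      p.eval (dot x (equator θ)) * dot x (equator θ)
  have hF : Continuous F.uncurry := by
    simp only [F, Function.uncurry_def, dot_equator]
    fun_prop
  have hmean : ∀ x, ∫ θ in (0 : ℝ)..2 * Real.pi, F x θ = 0 := by
    intro x
    rw [intervalIntegral.integral_eq_sub_of_hasDerivAt
      (fun θ _ => hasDerivAt_eval_dot_equator_mul p x θ)
      ((hF.uncurry_left x).intervalIntegrable _ _)]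
    simp [dot_equator, add_comm (2 * Real.pi)]
  have hconst : ∀ θ, ∫ x, F x θ ∂sphereMeasure = ∫ x, ((derivative p).eval (dot x u) *
      dot x v ^ 2 - p.eval (dot x u) * dot x u) ∂sphereMeasure := fun θ =>
    integral_dot_dot_eq (by rw [huv, dot_equator_equator, add_sub_cancel_left, Real.cos_pi_div_two])
      fun s t => (derivative p).eval s * t ^ 2 - p.eval s * s
  have hint : Integrable (Function.uncurry fun θ x => F x θ)
      ((volume.restrict (Set.uIoc 0 (2 * Real.pi))).prod sphereMeasure) := by
    rw [← Measure.restrict_univ (μ := sphereMeasure), Measure.prod_restrict]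
    exact ((hF.comp continuous_swap).continuousOn.integrableOn_compact
      (isCompact_uIcc.prod isCompact_univ)).mono_set (Set.prod_mono_left Set.uIoc_subset_uIcc)
  have hswap := intervalIntegral_integral_swap hint
  simp only [hconst, hmean, intervalIntegral.integral_const, integral_zero, smul_eq_mul] at hswap
  exact (mul_eq_zero.mp hswap).resolve_left (by simp [Real.pi_ne_zero])

lemma integral_eval_derivative_dot (p : ℝ[X]) (c : S2) :
    ∫ x, (derivative ((X ^ 2 - 1) * p)).eval (dot x c) ∂sphereMeasure = 0 := by
  let D : S2 → S2 → ℝ := fun v x => (derivative p).eval (dot x (equator 0)) * dot x v ^ 2 -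
    p.eval (dot x (equator 0)) * dot x (equator 0)
  have hD : ∀ v, Continuous (D v) := fun v => by
    simp only [D]
    fun_prop
  have hsplit : ∀ x, (derivative ((X ^ 2 - 1) * p)).eval (dot x (equator 0)) =
      -(D (equator (Real.pi / 2)) x + D northPole x) := by
    intro x
    have hx := dot_equator_sq_add_sq_add_sq x
    simp only [D, derivative_mul, derivative_sub, derivative_X_pow, derivative_one, eval_add,
      eval_mul, eval_sub, eval_pow, eval_X, eval_one, eval_C, eval_zero]
    push_cast
    linear_combination (derivative p).eval (dot x (equator 0)) * hx
  calc ∫ x, (derivative ((X ^ 2 - 1) * p)).eval (dot x c) ∂sphereMeasure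
      = ∫ x, (derivative ((X ^ 2 - 1) * p)).eval (dot x (equator 0)) ∂sphereMeasure :=
        integral_dot_dot_eq (by rw [dot_self, dot_self])
          fun s _ => (derivative ((X ^ 2 - 1) * p)).eval s
    _ = -(∫ x, D (equator (Real.pi / 2)) x ∂sphereMeasure +
          ∫ x, D northPole x ∂sphereMeasure) := by
        simp only [hsplit]
        rw [integral_neg, integral_add (integrable_of_continuous (hD _))
          (integrable_of_continuous (hD _))]
    _ = 0 := by
        rw [integral_eval_derivative_dot_mul_sq_sub (by simp [dot_equator_equator]),
          integral_eval_derivative_dot_mul_sq_sub (dot_equator_northPole 0), add_zero, neg_zero]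

/-- Archimedes' theorem: the projection of the sphere to a diameter preserves area up to a
constant factor. -/
lemma integral_eval_dot (p : ℝ[X]) (c : S2) :
    ∫ x, p.eval (dot x c) ∂sphereMeasure = 2 * Real.pi * segmentIntegral p := by
  have hint : ∀ p : ℝ[X], Integrable (fun x => p.eval (dot x c)) sphereMeasure := fun p =>
    integrable_of_continuous (by fun_prop)
  let Λ : ℝ[X] →ₗ[ℝ] ℝ :=
    { toFun := fun p => ∫ x, p.eval (dot x c) ∂sphereMeasure
      map_add' := fun p q => by simp only [eval_add, integral_add (hint p) (hint q)]
      map_smul' := fun a p => by simp [integral_const_mul] }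
  have hΛ_one : Λ 1 = 4 * Real.pi := by simp [Λ, sphereMeasure_real_univ]
  have hΛ := eq_smul_segmentIntegral (Λ := Λ) fun p => integral_eval_derivative_dot p c
  calc Λ p = (Λ 1 / 2) * segmentIntegral p := DFunLike.congr_fun hΛ p
    _ = 2 * Real.pi * segmentIntegral p := by rw [hΛ_one]; ring

end ZonalIntegrals

section FunkHecke

lemma integrable_mul_of_continuous {T : Type*} [TopologicalSpace T] [CompactSpace T]
    [MeasurableSpace T] [OpensMeasurableSpace T] {μ : Measure T} {f g : T → ℝ}
    (hf : Integrable f μ) (hg : Continuous g) : Integrable (fun x => f x * g x) μ :=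
  hf.mul_of_top_left (hg.memLp_top_of_hasCompactSupport (.of_compactSpace g) μ)

lemma X_pow_mul_one_sub_X_sq_pow_mem_degreeLT {k m n : ℕ} (h : k + 2 * m < n) :
    (X ^ k * (1 - X ^ 2) ^ m : ℝ[X]) ∈ degreeLT ℝ n := by
  have hdeg : (X ^ k * (1 - X ^ 2) ^ m : ℝ[X]).natDegree ≤ k + m * 2 := by compute_degree
  exact mem_degreeLT.mpr (degree_le_natDegree.trans_lt (by exact_mod_cast by omega))

namespace IsRotationInvariant

variable {K : S2 → S2 → ℝ} (hK : IsRotationInvariant K)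
include hK

lemma integral_mul_dot_pow_mul_dot_pow_of_odd {y u : S2} (hyu : dot y u = 0) (k : ℕ) {m : ℕ}
    (hm : Odd m) : ∫ x, K x y * (dot x y ^ k * dot x u ^ m) ∂sphereMeasure = 0 := by
  have hneg := hK.integral_mul_dot_eq (y := y) (c := u) (y' := y) (c' := -u)
    (by rw [dot_neg_right, hyu, neg_zero]) fun s t => s ^ k * t ^ m
  simp only [dot_neg_right, hm.neg_pow, mul_neg, integral_neg] at hneg
  linarith

variable (hint : Integrable K.uncurry (sphereMeasure.prod sphereMeasure))
include hint

lemma integrable_left (y : S2) : Integrable (fun x => K x y) sphereMeasure := by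
  have : NeZero sphereMeasure := ⟨Measure.toSphere_ne_zero _⟩
  obtain ⟨z, hz⟩ := hint.prod_left_ae.exists
  obtain ⟨ρ, hρ, hy, -⟩ := exists_rotate_pair ((dot_self y).trans (dot_self z).symm)
  convert (measurePreserving_rotateEquiv ρ).integrable_comp_of_integrable hz using 2 with x
  exact (hy ▸ hK ρ hρ x y).symm

lemma integral_mul_dot_equator_pow (θ : ℝ) (n : ℕ) :
    ∫ x, K x (equator 0) * dot x (equator θ) ^ n ∂sphereMeasure = ∑ k ∈ Finset.range (n + 1),
      (Real.cos θ ^ k * Real.sin θ ^ (n - k) * n.choose k) * ∫ x, K x (equator 0) *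
        (dot x (equator 0) ^ k * dot x (equator (Real.pi / 2)) ^ (n - k)) ∂sphereMeasure := by
  have hexpand : ∀ x, K x (equator 0) * dot x (equator θ) ^ n = ∑ k ∈ Finset.range (n + 1),
      (Real.cos θ ^ k * Real.sin θ ^ (n - k) * n.choose k) * (K x (equator 0) *
        (dot x (equator 0) ^ k * dot x (equator (Real.pi / 2)) ^ (n - k))) := fun x => by
    rw [dot_equator_eq_add, add_pow, Finset.mul_sum]
    exact Finset.sum_congr rfl fun k _ => by ring
  simp only [hexpand, ← integral_const_mul]
  exact integral_finsetSum _ fun k _ => (integrable_mul_of_continuous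
    (hK.integrable_left hint (equator 0)) (by fun_prop)).const_mul _

/-- Place `y` and `c` on the equator, at angle `θ` with `cos θ = y · c`: the odd powers of `sin θ`
in the binomial expansion come with vanishing coefficients. -/
lemma exists_integral_mul_dot_pow (n : ℕ) : ∃ q ∈ degreeLT ℝ (n + 1), ∀ y c,
    ∫ x, K x y * dot x c ^ n ∂sphereMeasure = q.eval (dot y c) := by
  let A : ℕ → ℝ := fun k => ∫ x, K x (equator 0) *
    (dot x (equator 0) ^ k * dot x (equator (Real.pi / 2)) ^ (n - k)) ∂sphereMeasure
  have hA : ∀ θ k, A k * Real.sin θ ^ (n - k) = A k * (1 - Real.cos θ ^ 2) ^ ((n - k) / 2) := by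
    intro θ k
    rcases Nat.even_or_odd (n - k) with heven | hodd
    · rw [← Real.sin_sq, ← pow_mul, Nat.two_mul_div_two_of_even heven]
    · have hzero : A k = 0 :=
        hK.integral_mul_dot_pow_mul_dot_pow_of_odd (by simp [dot_equator_equator]) k hodd
      rw [hzero, zero_mul, zero_mul]
  refine ⟨∑ k ∈ Finset.range (n + 1),
    (A k * n.choose k) • (X ^ k * (1 - X ^ 2) ^ ((n - k) / 2)), ?_, fun y c => ?_⟩
  · exact sum_mem fun k hk => Submodule.smul_mem _ _
      (X_pow_mul_one_sub_X_sq_pow_mem_degreeLT (by rw [Finset.mem_range] at hk; omega))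
  obtain ⟨θ, hθ⟩ : ∃ θ, Real.cos θ = dot y c :=
    ⟨_, Real.cos_arccos (abs_le.mp (abs_dot_le_one y c)).1 (abs_le.mp (abs_dot_le_one y c)).2⟩
  rw [hK.integral_mul_dot_eq (y' := equator 0) (c' := equator θ)
    (by rw [dot_equator_equator, sub_zero, hθ]) fun _ t => t ^ n,
    hK.integral_mul_dot_equator_pow hint, eval_finsetSum, ← hθ]
  refine Finset.sum_congr rfl fun k _ => ?_
  simp only [eval_smul, eval_mul, eval_pow, eval_sub, eval_X, eval_one, smul_eq_mul]
  linear_combination Real.cos θ ^ k * n.choose k * hA θ k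

lemma exists_integral_mul_eval_dot {n : ℕ} {p : ℝ[X]} (hp : p ∈ degreeLT ℝ n) :
    ∃ q ∈ degreeLT ℝ n, ∀ y c,
      ∫ x, K x y * p.eval (dot x c) ∂sphereMeasure = q.eval (dot y c) := by
  choose Q hQdeg hQ using hK.exists_integral_mul_dot_pow hint
  let a := degreeLTEquiv ℝ n ⟨p, hp⟩
  refine ⟨∑ i, a i • Q i, sum_mem fun i _ => Submodule.smul_mem _ _
    (degreeLT_mono (Nat.succ_le_of_lt i.isLt) (hQdeg i)), fun y c => ?_⟩
  have hexpand : ∀ x, K x y * p.eval (dot x c) = ∑ i, a i * (K x y * dot x c ^ (i : ℕ)) :=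
    fun x => by
      rw [eval_eq_sum_degreeLTEquiv hp, Finset.mul_sum]
      exact Finset.sum_congr rfl fun i _ => mul_left_comm _ _ _
  simp only [hexpand]
  rw [integral_finsetSum _ fun i _ => (integrable_mul_of_continuous (hK.integrable_left hint y)
    (by fun_prop)).const_mul _, eval_finsetSum]
  exact Finset.sum_congr rfl fun i _ => by rw [integral_const_mul, hQ, eval_smul, smul_eq_mul]

lemma integral_integral_mul_comm {f g : S2 → ℝ} (hf : Continuous f) (hg : Continuous g) :
    ∫ y, (∫ x, K x y * f x ∂sphereMeasure) * g y ∂sphereMeasure =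
      ∫ y, (∫ x, K x y * g x ∂sphereMeasure) * f y ∂sphereMeasure := by
  have hprod : Integrable (Function.uncurry fun y x => K x y * f x * g y)
      (sphereMeasure.prod sphereMeasure) := by
    refine (integrable_mul_of_continuous hint.swap (g := fun q => f q.2 * g q.1)
      (by fun_prop)).congr (.of_forall fun q => ?_)
    exact (mul_assoc _ _ _).symm
  simp only [← integral_mul_const]
  rw [integral_integral_swap hprod]
  congr 1 with x
  congr 1 with y
  rw [hK.symm y x, mul_right_comm]

/-- The Funk–Hecke formula. -/
lemma integral_mul_legendreP_dot (n : ℕ) (e y c : S2) :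
    ∫ x, K x y * (legendreP n).eval (dot x c) ∂sphereMeasure =
      (∫ x, K x e * (legendreP n).eval (dot x e) ∂sphereMeasure) *
        (legendreP n).eval (dot y c) := by
  obtain ⟨q, hqdeg, hq⟩ := hK.exists_integral_mul_eval_dot hint (legendreP_mem_degreeLT n)
  have horth : ∀ p ∈ degreeLT ℝ n, segmentIntegral (q * p) = 0 := by
    intro p hp
    obtain ⟨r, hrdeg, hr⟩ := hK.exists_integral_mul_eval_dot hint hp
    have hself : 2 * Real.pi * segmentIntegral (q * p) =
        2 * Real.pi * segmentIntegral (r * legendreP n) := by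
      simp only [← integral_eval_dot _ e, eval_mul, ← hq, ← hr]
      exact hK.integral_integral_mul_comm hint (by fun_prop) (by fun_prop)
    rw [mul_comm r, segmentIntegral_legendreP_mul hrdeg, mul_zero] at hself
    exact (mul_eq_zero.mp hself).resolve_left (by positivity)
  rw [hq, hq, dot_self, ← smul_eq_mul, ← eval_smul, ← eq_smul_legendreP hqdeg horth]

end IsRotationInvariant

lemma integral_legendreP_dot_mul_legendreP_dot (l m : ℕ) (c c' : S2) :
    ∫ x, (legendreP l).eval (dot x c) * (legendreP m).eval (dot x c') ∂sphereMeasure =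
      if l = m then 4 * Real.pi / (2 * l + 1) * (legendreP l).eval (dot c c') else 0 := by
  have hK : IsRotationInvariant fun x y => (legendreP l).eval (dot x y) := fun ρ _ x y => by
    simp only [dot_rotate]
  rw [hK.integral_mul_legendreP_dot (integrable_of_continuous (by fun_prop)) m c c c']
  simp only [← eval_mul, integral_eval_dot]
  split_ifs with h
  · rw [← h, segmentIntegral_legendreP_mul_self]
    ring
  · rw [segmentIntegral_legendreP_mul_of_ne h, mul_zero, zero_mul]

lemma integral_legendreL_dot_mul_legendreL_dot (l m : ℕ) (c c' : S2) :
    ∫ x, (legendreL l).eval (dot x c) * (legendreL m).eval (dot x c') ∂sphereMeasure =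
      if l = m then (legendreL l).eval (dot c c') else 0 := by
  simp only [legendreL, eval_mul, eval_C, mul_mul_mul_comm, integral_const_mul,
    integral_legendreP_dot_mul_legendreP_dot]
  split_ifs with h
  · rw [← h]
    field_simp
  · rw [mul_zero]

end FunkHecke

section RandomFields

variable {T Ω : Type*} [MeasurableSpace T] [MeasurableSpace Ω] {μ : Measure T} {P : Measure Ω}
  [IsFiniteMeasure μ] [SFinite P] {Y Z : T → Ω → ℝ}

lemma integrable_mul_of_memLp_uncurry (hY : MemLp Y.uncurry 2 (μ.prod P))
    (hZ : MemLp Z.uncurry 2 (μ.prod P)) :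
    Integrable (fun q : (T × T) × Ω => Y q.1.1 q.2 * Z q.1.2 q.2) ((μ.prod μ).prod P) := by
  have hsnd : ∀ {W : T → Ω → ℝ}, MemLp W.uncurry 2 (μ.prod P) →
      MemLp (fun q : (T × T) × Ω => W q.1.2 q.2) 2 ((μ.prod μ).prod P) := fun hW =>
    (hW.comp_snd μ).comp_measurePreserving (measurePreserving_prodAssoc μ μ P)
  have hfst : MemLp (fun q : (T × T) × Ω => Y q.1.1 q.2) 2 ((μ.prod μ).prod P) :=
    (hsnd hY).comp_measurePreserving (Measure.measurePreserving_swap.prod (.id P))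
  exact hfst.integrable_mul (hsnd hZ)

lemma memLp_integral (hY : MemLp Y.uncurry 2 (μ.prod P)) :
    MemLp (fun ω => ∫ x, Y x ω ∂μ) 2 P := by
  have hmeas : AEStronglyMeasurable (fun ω => ∫ x, Y x ω ∂μ) P :=
    hY.aestronglyMeasurable.prod_swap.integral_prod_right'
  rw [memLp_two_iff_integrable_sq hmeas]
  refine (integrable_mul_of_memLp_uncurry hY hY).integral_prod_right.congr (.of_forall fun ω => ?_)
  exact (integral_prod_mul (fun x => Y x ω) fun x => Y x ω).trans (sq _).symm

lemma integral_integral_mul_integral (hY : MemLp Y.uncurry 2 (μ.prod P))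
    (hZ : MemLp Z.uncurry 2 (μ.prod P)) :
    ∫ ω, (∫ x, Y x ω ∂μ) * (∫ y, Z y ω ∂μ) ∂P =
      ∫ y, ∫ x, ∫ ω, Y x ω * Z y ω ∂P ∂μ ∂μ := by
  have hint := integrable_mul_of_memLp_uncurry hY hZ
  calc ∫ ω, (∫ x, Y x ω ∂μ) * (∫ y, Z y ω ∂μ) ∂P
      = ∫ ω, ∫ q : T × T, Y q.1 ω * Z q.2 ω ∂μ.prod μ ∂P :=
        integral_congr_ae (.of_forall fun ω =>
          (integral_prod_mul (fun x => Y x ω) fun y => Z y ω).symm)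
    _ = ∫ q : T × T, ∫ ω, Y q.1 ω * Z q.2 ω ∂P ∂μ.prod μ :=
        integral_integral_swap (f := fun ω (q : T × T) => Y q.1 ω * Z q.2 ω) hint.swap
    _ = ∫ y, ∫ x, ∫ ω, Y x ω * Z y ω ∂P ∂μ ∂μ := integral_prod_symm _ hint.integral_prod_left

end RandomFields

section IsotropicFields

variable {Ω : Type*} [MeasurableSpace Ω] {P : Measure Ω} {X : S2 → Ω → ℝ}

/-- The covariance kernel of a centered random field. -/
noncomputable def covKernel (P : Measure Ω) (X : S2 → Ω → ℝ) (x y : S2) : ℝ :=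
  ∫ ω, X x ω * X y ω ∂P

/-- A zero-mean, second-order stationary real random field on the sphere, with no continuity
assumption. -/
structure IsIsotropicField (P : Measure Ω) (X : S2 → Ω → ℝ) : Prop where
  aestronglyMeasurable : AEStronglyMeasurable X.uncurry (sphereMeasure.prod P)
  memLp : ∀ x, MemLp (X x) 2 P
  mean_zero : ∀ x, ∫ ω, X x ω ∂P = 0
  stationary : IsRotationInvariant (covKernel P X)

lemma IsStationaryField.isIsotropicField (hX : IsStationaryField P X) : IsIsotropicField P X :=
  ⟨hX.aestronglyMeasurable, hX.memLp, hX.mean_zero, hX.stationary⟩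

/-- The coefficient of the random field `X` against the zonal function `x ↦ p (x · c)`. -/
noncomputable def zonalCoeff (X : S2 → Ω → ℝ) (p : ℝ[X]) (c : S2) (ω : Ω) : ℝ :=
  ∫ x, X x ω * p.eval (dot x c) ∂sphereMeasure

omit [MeasurableSpace Ω] in
lemma harmonicCoeff_zero (X : S2 → Ω → ℝ) (l : ℕ) (ω : Ω) :
    harmonicCoeff X l 0 ω = ((√((2 * l + 1) / (4 * Real.pi)) *
      zonalCoeff X (legendreP l) northPole ω : ℝ) : ℂ) := by
  rw [zonalCoeff, ← integral_const_mul, ← integral_complex_ofReal, harmonicCoeff]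
  congr 1 with x
  have hfact : (l.factorial : ℝ) / l.factorial = 1 := div_self (by positivity)
  simp only [sphericalHarmonic, Int.natAbs_zero, pow_zero, Nat.sub_zero, Nat.add_zero, hfact,
    mul_one, Function.iterate_zero, id, dot_northPole, map_mul, Complex.conj_ofReal,
    Complex.ofReal_mul]
  ring

namespace IsIsotropicField

variable [IsFiniteMeasure P] (hX : IsIsotropicField P X)
include hX

lemma memLp_uncurry : MemLp X.uncurry 2 (sphereMeasure.prod P) := by
  have hvar : ∀ x, ∫ ω, X x ω ^ 2 ∂P = ∫ ω, X northPole ω ^ 2 ∂P := fun x => by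
    simpa only [covKernel, sq] using
      hX.stationary.eq_of_dot_eq ((dot_self x).trans (dot_self northPole).symm)
  rw [memLp_two_iff_integrable_sq hX.aestronglyMeasurable]
  refine (integrable_prod_iff (hX.aestronglyMeasurable.pow 2)).mpr
    ⟨.of_forall fun x => (hX.memLp x).integrable_sq, ?_⟩
  simp [Function.uncurry, hvar]

lemma memLp_uncurry_mul {f : S2 → ℝ} (hf : Continuous f) :
    MemLp (Function.uncurry fun x ω => X x ω * f x) 2 (sphereMeasure.prod P) :=
  ((hf.memLp_top_of_hasCompactSupport (.of_compactSpace f) sphereMeasure).comp_fst P).mul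
    hX.memLp_uncurry

lemma integrable_covKernel :
    Integrable (covKernel P X).uncurry (sphereMeasure.prod sphereMeasure) :=
  (integrable_mul_of_memLp_uncurry hX.memLp_uncurry hX.memLp_uncurry).integral_prod_left

lemma memLp_zonalCoeff (p : ℝ[X]) (c : S2) : MemLp (zonalCoeff X p c) 2 P :=
  memLp_integral (hX.memLp_uncurry_mul (by fun_prop))

lemma integral_zonalCoeff (p : ℝ[X]) (c : S2) : ∫ ω, zonalCoeff X p c ω ∂P = 0 := by
  have hint := (hX.memLp_uncurry_mul (f := fun x => p.eval (dot x c))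
    (by fun_prop)).integrable one_le_two
  simp only [zonalCoeff]
  rw [integral_integral_swap (f := fun ω x => X x ω * p.eval (dot x c)) hint.swap]
  simp only [integral_mul_const, hX.mean_zero, zero_mul, integral_zero]

lemma integral_zonalCoeff_mul_zonalCoeff (p q : ℝ[X]) (c c' : S2) :
    ∫ ω, zonalCoeff X p c ω * zonalCoeff X q c' ω ∂P =
      ∫ y, (∫ x, covKernel P X x y * p.eval (dot x c) ∂sphereMeasure) * q.eval (dot y c')
        ∂sphereMeasure := by
  simp only [zonalCoeff]
  rw [integral_integral_mul_integral (hX.memLp_uncurry_mul (by fun_prop))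
    (hX.memLp_uncurry_mul (by fun_prop))]
  simp only [covKernel, ← integral_mul_const]
  congr! 6
  ring

lemma powerSpectrum_eq (l : ℕ) (e : S2) : powerSpectrum P X l =
    ∫ x, covKernel P X x e * (legendreP l).eval (dot x e) ∂sphereMeasure := by
  have hsq : ∀ ω, ‖harmonicCoeff X l 0 ω‖ ^ 2 = (2 * l + 1) / (4 * Real.pi) *
      (zonalCoeff X (legendreP l) northPole ω * zonalCoeff X (legendreP l) northPole ω) := by
    intro ω
    rw [harmonicCoeff_zero, Complex.norm_real, Real.norm_eq_abs, sq_abs, mul_pow,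
      Real.sq_sqrt (by positivity), sq (zonalCoeff _ _ _ _)]
  simp only [powerSpectrum, hsq, integral_const_mul, hX.integral_zonalCoeff_mul_zonalCoeff]
  simp only [hX.stationary.integral_mul_legendreP_dot hX.integrable_covKernel l e _ northPole,
    mul_assoc, integral_const_mul, integral_legendreP_dot_mul_legendreP_dot, if_pos, dot_self,
    legendreP_eval_one]
  field_simp

lemma integral_covKernel_mul_legendreL_dot (l : ℕ) (y c : S2) :
    ∫ x, covKernel P X x y * (legendreL l).eval (dot x c) ∂sphereMeasure =
      powerSpectrum P X l * (legendreL l).eval (dot y c) := by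
  simp only [legendreL, eval_mul, eval_C, mul_left_comm _ ((2 * (l : ℝ) + 1) / (4 * Real.pi)),
    integral_const_mul]
  rw [hX.powerSpectrum_eq l c,
    ← hX.stationary.integral_mul_legendreP_dot hX.integrable_covKernel l c y c]

end IsIsotropicField

end IsotropicFields

section Windows

/-- The polynomial `∑ b_ℓ L_ℓ` of a window `b` supported in the finite set `s`. -/
noncomputable def windowPoly (s : Finset ℕ) (b : ℕ → ℝ) : ℝ[X] :=
  ∑ l ∈ s, b l • legendreL l

lemma eval_windowPoly (s : Finset ℕ) (b : ℕ → ℝ) (t : ℝ) :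
    (windowPoly s b).eval t = ∑ l ∈ s, b l * (legendreL l).eval t := by
  simp only [windowPoly, eval_finsetSum, eval_smul, smul_eq_mul]

lemma integral_windowPoly_dot_mul_windowPoly_dot (s : Finset ℕ) (b b' : ℕ → ℝ) (c c' : S2) :
    ∫ x, (windowPoly s b).eval (dot x c) * (windowPoly s b').eval (dot x c') ∂sphereMeasure =
      (windowPoly s (b * b')).eval (dot c c') := by
  simp only [eval_windowPoly, Finset.sum_mul_sum, mul_mul_mul_comm]
  rw [integral_finsetSum _ fun l _ => integrable_of_continuous (by fun_prop)]
  refine Finset.sum_congr rfl fun l hl => ?_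
  rw [integral_finsetSum _ fun m _ => integrable_of_continuous (by fun_prop)]
  simp only [integral_const_mul, integral_legendreL_dot_mul_legendreL_dot, mul_ite, mul_zero]
  rw [Finset.sum_ite_eq, if_pos hl, Pi.mul_apply]

variable {Ω : Type*}

lemma needletCoeff_eq_zonalCoeff {s : Finset ℕ} {b : ℕ → ℝ} (hb : ∀ l ∉ s, b l = 0) (c : S2)
    {w : ℝ} (hw : 0 < w) (X : S2 → Ω → ℝ) :
    needletCoeff b c w X = zonalCoeff X (windowPoly s b) c := by
  have hneedlet : ∀ x, needlet b c w x = √w * (windowPoly s b).eval (dot x c) := fun x => by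
    rw [needlet, eval_windowPoly, tsum_eq_sum fun l hl => by rw [hb l hl, zero_mul]]
  funext ω
  simp only [needletCoeff, hneedlet, zonalCoeff, mul_left_comm _ √w, integral_const_mul]
  exact mul_inv_cancel_left₀ (Real.sqrt_pos.mpr hw).ne' _

namespace IsIsotropicField

variable [MeasurableSpace Ω] {P : Measure Ω} [IsFiniteMeasure P] {X : S2 → Ω → ℝ}
  (hX : IsIsotropicField P X)
include hX

lemma integral_covKernel_mul_windowPoly_dot (s : Finset ℕ) (b : ℕ → ℝ) (y c : S2) :
    ∫ x, covKernel P X x y * (windowPoly s b).eval (dot x c) ∂sphereMeasure =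
      (windowPoly s (b * powerSpectrum P X)).eval (dot y c) := by
  simp only [eval_windowPoly, Finset.mul_sum, mul_left_comm _ (b _)]
  rw [integral_finsetSum _ fun l _ => (integrable_mul_of_continuous
    (hX.stationary.integrable_left hX.integrable_covKernel y) (by fun_prop)).const_mul _]
  simp only [integral_const_mul, hX.integral_covKernel_mul_legendreL_dot, Pi.mul_apply, mul_assoc]

lemma integral_zonalCoeff_windowPoly_mul (s : Finset ℕ) (b b' : ℕ → ℝ) (c c' : S2) :
    ∫ ω, zonalCoeff X (windowPoly s b) c ω * zonalCoeff X (windowPoly s b') c' ω ∂P =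
      (windowPoly s (b * powerSpectrum P X * b')).eval (dot c c') := by
  simp only [hX.integral_zonalCoeff_mul_zonalCoeff, hX.integral_covKernel_mul_windowPoly_dot,
    integral_windowPoly_dot_mul_windowPoly_dot]

end IsIsotropicField

end Windows

end Needlet

theorem proposition3_general {Ω : Type*} [MeasurableSpace Ω] {P : Measure Ω} [IsFiniteMeasure P]
    {X : Needlet.S2 → Ω → ℝ} (hX : Needlet.IsIsotropicField P X) {b b' : ℕ → ℝ}
    (hb : b.support.Finite) (hb' : b'.support.Finite) (c c' : Needlet.S2) {w w' : ℝ}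
    (hw : 0 < w) (hw' : 0 < w') :
    (MemLp (Needlet.needletCoeff b c w X) 2 P ∧
      ∫ ω, Needlet.needletCoeff b c w X ω ∂P = 0) ∧
    covariance (Needlet.needletCoeff b c w X) (Needlet.needletCoeff b' c' w' X) P =
      ∑' l : ℕ, b l * b' l * Needlet.powerSpectrum P X l *
        (Needlet.legendreL l).eval (Needlet.dot c c') := by
  let s := hb.toFinset ∪ hb'.toFinset
  have hs : ∀ l ∉ s, b l = 0 ∧ b' l = 0 := fun l hl => by simpa [s] using hl
  rw [Needlet.needletCoeff_eq_zonalCoeff (fun l hl => (hs l hl).1) c hw,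
    Needlet.needletCoeff_eq_zonalCoeff (fun l hl => (hs l hl).2) c' hw']
  refine ⟨⟨hX.memLp_zonalCoeff _ c, hX.integral_zonalCoeff _ c⟩, ?_⟩
  rw [tsum_eq_sum (s := s) fun l hl => by simp [hs l hl]]
  simp only [covariance, hX.integral_zonalCoeff, sub_zero,
    hX.integral_zonalCoeff_windowPoly_mul, Needlet.eval_windowPoly, Pi.mul_apply,
    mul_right_comm (b _)]

theorem proposition3 {Ω : Type*} [MeasurableSpace Ω] (P : Measure Ω) [IsProbabilityMeasure P]
    (X : Needlet.S2 → Ω → ℝ) (hX : Needlet.IsStationaryField P X)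
    (b : ℕ → ℕ → ℝ) (L : ℕ → ℕ) (hb : ∀ j l, L j < l → b j l = 0)
    (N : ℕ → ℕ) (ξ : (j : ℕ) → Fin (N j) → Needlet.S2)
    (w : (j : ℕ) → Fin (N j) → ℝ) (hw : ∀ j k, 0 < w j k) :
    (∀ j k, MemLp (Needlet.needletCoeff (b j) (ξ j k) (w j k) X) 2 P ∧
      ∫ ω, Needlet.needletCoeff (b j) (ξ j k) (w j k) X ω ∂P = 0) ∧
    ∀ j k k',
      covariance (Needlet.needletCoeff (b j) (ξ j k) (w j k) X)
          (Needlet.needletCoeff (b j) (ξ j k') (w j k') X) P =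
        ∑' l : ℕ, b j l ^ 2 * Needlet.powerSpectrum P X l *
          (Needlet.legendreL l).eval (Needlet.dot (ξ j k) (ξ j k')) := by
  have hsupp : ∀ j, (b j).support.Finite := fun j =>
    (Set.finite_Iic (L j)).subset fun l hl => not_lt.mp fun hlt => hl (hb j l hlt)
  have hpair := fun j k k' => proposition3_general hX.isIsotropicField (hsupp j) (hsupp j)
    (ξ j k) (ξ j k') (hw j k) (hw j k')
  exact ⟨fun j k => (hpair j k k).1, fun j k k' => by simpa only [sq] using (hpair j k k').2⟩
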